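/- **Garden-hose model.** Let $f:\mathcal X\times\mathcal Y\to\{0,1\}$. A garden-hose protocol with $s$ pipes consists of a set $V$ of $s$ vertices, an extra vertex $t\notin V$ (the tap), for each $x\in\mathcal X$ a matching $E_A(x)$ on $V\cup\{t\}$, and for each $y\in\mathcal Y$ a matching $E_B(y)$ on $V$ (matchings need not be perfect). In the graph $(V\cup\{t\},\,E_A(x)\cup E_B(y))$ the vertex $t$ has degree at most $1$ and every other vertex has degree at most $2$, so there is a unique maximal path starting at $t$. The protocol computes $f$ if for all $x,y$ the length of this path is even if and only if $f(x,y)=0$. The garden-hose complexity $GH(f)$ is the smallest $s$ such that some garden-hose protocol with $s$ pipes computes $f$. **Corollary (distributed Majority).** For $n\ge 0$ let $DMAJ_n:\{0,1\}^n\times\{0,1\}^n\to\{0,1\}$ be given by $DMAJ_n(x,y)=1$ if and only if $\sum_{i=1}^n x_iy_i\ge \frac n2$. Then every $DMAJ_n$ is computed by some garden-hose protocol (so that $GH(DMAJ_n)$ is a well-defined natural number), and, as $n\to\infty$, $$GH(DMAJ_n)=O(n\log^3 n).$$ In particular, the conjectured bound $GH(DMAJ_n)=\Omega(n^2)$ is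 false. -/

import Mathlib

open Asymptotics Filter

/-- The edges of `G` form a matching: every vertex lies on at most one edge. -/
def SimpleGraph.EdgesFormMatching {W : Type*} (G : SimpleGraph W) : Prop :=
  ∀ u v w : W, G.Adj u v → G.Adj u w → v = w

/-- A garden-hose protocol with pipe set `V`. The vertex set is `V` together with the tap, which is
`none : Option V`. Alice's input determines a matching on the pipes and the tap, Bob's input
determines a matching on the pipes. -/
structure GardenHoseProtocol (X Y V : Type*) where
  alice : X → SimpleGraph (Option V)
  bob : Y → SimpleGraph V
  alice_matching : ∀ x, (alice x).EdgesFormMatching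
  bob_matching : ∀ y, (bob y).EdgesFormMatching

namespace GardenHoseProtocol

variable {X Y V : Type*}

/-- The graph formed by Alice's and Bob's edges together. -/
def graph (P : GardenHoseProtocol X Y V) (x : X) (y : Y) : SimpleGraph (Option V) :=
  P.alice x ⊔ (P.bob y).map some

/-- `p` is the path of the water: it starts at the tap, repeats no vertex and ends where it cannot be
continued to a new vertex. As the tap has degree at most one and every other vertex has degree at
most two, there is only one such path. -/
def IsWaterPath (P : GardenHoseProtocol X Y V) (x : X) (y : Y) {v : Option V}
    (p : (P.graph x y).Walk none v) : Prop :=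
  p.IsPath ∧ ∀ w, (P.graph x y).Adj v w → w ∈ p.support

/-- The protocol computes `f`: on every input the path of the water has even length (the water
spills on Alice's side) if and only if `f` takes the value 0. -/
def Computes (P : GardenHoseProtocol X Y V) (f : X → Y → Bool) : Prop :=
  ∀ x y, ∃ (v : Option V) (p : (P.graph x y).Walk none v),
    P.IsWaterPath x y p ∧ (Even p.length ↔ f x y = false)

end GardenHoseProtocol

/-- `f` has a garden-hose protocol with `s` pipes. -/
def HasGardenHoseProtocol {X Y : Type*} (f : X → Y → Bool) (s : ℕ) : Prop :=
  ∃ P : GardenHoseProtocol X Y (Fin s), P.Computes f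

/-- The garden-hose complexity of `f`: the smallest number of pipes of a protocol computing `f`. -/
noncomputable def gardenHoseComplexity {X Y : Type*} (f : X → Y → Bool) : ℕ :=
  sInf {s : ℕ | HasGardenHoseProtocol f s}

/-- Distributed Majority: the value is 1 if and only if `∑ i, x i * y i ≥ n / 2`. -/
def distributedMajority (n : ℕ) (x y : Fin n → Bool) : Bool :=
  decide ((∑ i, (x i).toNat * (y i).toNat : ℕ) ≥ (n : ℚ) / 2)

/-!
Distributed Majority asks for the sign of `4 * S + 1 - 2 * n`, where `S` is the number of common ones
of `x` and `y`. The protocol arises from an oblivious branching program of size `O(n * log n ^ 3)` in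
which every instruction reads one product `x i * y i`, as in the work of Sinha and Thathachar on
threshold functions.

*Branching programs become protocols.* The configurations of an oblivious program on a fixed input
form a forest, each configuration having its successor as parent. The water follows an Euler tour of
this forest. Each edge of the forest gives two pipes, one for each direction, and the connections made
at a configuration depend only on the instruction that leads to it, hence on the input of one player
if the players act alternately. The tour is a partial injection (`EulerTour.Step.injective`)
although the program may merge configurations. It begins at the initial configuration and therefore
ends at the root above it (`EulerTour.reach_up_ancestor`), the parity of whose level decides the
parity of the path. So the number of pipes is linear in the size of the program
(`AndStep.hasGardenHoseProtocol`).

*Estimating with few states.* A counter modulo `W`, a multiple of `q`, can add `S * a / q` exactly to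
its value divided by `W`, seen modulo one. Passing from one modulus to the next only rounds this
value to a new grid. Hence a sum of `k` terms `S * a / q` is estimated modulo one with error `k / W` by
`O(W)` states (`Majority.eval_phase`). There is no need to store the residues of `S`.

*Finding the sign.* For `L = m.centralBinom`, which exceeds `2 ^ m`, all prime powers dividing `L` are
at most `2 * m`, so `1 / L` is a sum of at most `2 * m` fractions with denominators at most `2 * m`
(`exists_list_sum_eq_one_div_centralBinom`). Thus `O(m)` states suffice to estimate
`(4 * S + 1 - 2 * n) * 2 ^ j / L` modulo one up to `1 / 16`. For `j = 0` this quantity is small if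
`m` is about `log n`. The program doubles it until it is visibly different from 0, at which point it is
still less than `1 / 4` in absolute value and its residue shows its sign
(`Majority.eval_program_aux`). As `4 * S + 1 - 2 * n` is a nonzero integer and `L ≤ 4 ^ m`, `2 * m`
rounds suffice. Each round has at most `2 * m` passes over the `n` products.
-/

/-! ### Paths along a partial injection -/

/-- If the edges of `G` are the pairs of a relation `N` under which no two elements have a common
successor, then from a source of `N` the iteration of `N` never returns to an earlier vertex, and
it traces out a maximal path of `G`. -/
theorem SimpleGraph.exists_maximal_path_of_reflTransGen {W : Type*} {G : SimpleGraph W}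
    {N : W → W → Prop} (hG : ∀ u v, G.Adj u v ↔ N u v ∨ N v u)
    (hinj : ∀ u v w, N u w → N v w → u = v) {a b : W} (ha : ∀ u, ¬ N u a)
    (hab : Relation.ReflTransGen N a b) (hb : ∀ u, ¬ N b u) :
    ∃ p : G.Walk a b, p.IsPath ∧ ∀ w, G.Adj b w → w ∈ p.support := by
  -- On the path built so far, the predecessor of every vertex but `a` lies strictly before `b`.
  have key : ∀ {b : W}, Relation.ReflTransGen N a b → ∃ p : G.Walk a b, p.IsPath ∧
      ∀ u ∈ p.support, u ≠ a → ∃ v ∈ p.support, v ≠ b ∧ N v u := by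
    intro b hab
    induction hab with
    | refl => exact ⟨.nil, .nil, by simp⟩
    | @tail b c _ hbc ih =>
      obtain ⟨p, hp, hpred⟩ := ih
      have hc : c ∉ p.support := by
        intro hc
        obtain ⟨v, -, hvb, hvc⟩ := hpred c hc (by rintro rfl; exact ha _ hbc)
        exact hvb (hinj _ _ _ hvc hbc)
      refine ⟨p.concat ((hG _ _).2 (.inl hbc)), hp.concat hc _, ?_⟩
      intro u hu hua
      rw [SimpleGraph.Walk.support_concat] at hu
      rcases (by simpa using hu : u ∈ p.support ∨ u = c) with hu | hu
      · obtain ⟨v, hv, -, hvu⟩ := hpred u hu hua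
        refine ⟨v, by simp [SimpleGraph.Walk.support_concat, hv], ?_, hvu⟩
        rintro rfl; exact hc hv
      · obtain rfl : u = c := hu
        refine ⟨b, by simp [SimpleGraph.Walk.support_concat], ?_, hbc⟩
        rintro rfl; exact hc p.end_mem_support
  obtain ⟨p, hp, hpred⟩ := key hab
  refine ⟨p, hp, fun w hw => ?_⟩
  rcases (hG _ _).1 hw with h | h
  · exact absurd h (hb w)
  · obtain ⟨v, hv, -, hvb⟩ := hpred b p.end_mem_support (by rintro rfl; exact ha _ h)
    rwa [hinj _ _ _ h hvb]

/-! ### Renaming pipes -/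

namespace GardenHoseProtocol

variable {X Y V V' : Type*}

/-- Renaming the pipes of a protocol along a bijection. -/
def rename (P : GardenHoseProtocol X Y V) (e : V' ≃ V) : GardenHoseProtocol X Y V' where
  alice x := (P.alice x).comap (Option.map e)
  bob y := (P.bob y).comap e
  alice_matching x _ _ _ huv huw :=
    Option.map_injective e.injective (P.alice_matching x _ _ _ huv huw)
  bob_matching y _ _ _ huv huw := e.injective (P.bob_matching y _ _ _ huv huw)

theorem rename_graph_adj (P : GardenHoseProtocol X Y V) (e : V' ≃ V) (x : X) (y : Y)
    (u v : Option V') :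
    ((P.rename e).graph x y).Adj u v ↔ (P.graph x y).Adj (u.map e) (v.map e) := by
  cases u <;> cases v <;> simp [graph, rename, SimpleGraph.map_adj']

theorem Computes.rename {P : GardenHoseProtocol X Y V} {f : X → Y → Bool} (hP : P.Computes f)
    (e : V' ≃ V) : (P.rename e).Computes f := by
  intro x y
  obtain ⟨v, p, ⟨hp, hmax⟩, hf⟩ := hP x y
  have hsymm : ∀ u : Option V, (u.map e.symm).map e = u := by
    intro u; cases u <;> simp
  let φ : P.graph x y →g (P.rename e).graph x y :=
    ⟨Option.map e.symm, fun {a b} hab => by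
      rw [rename_graph_adj, hsymm, hsymm]; exact hab⟩
  refine ⟨φ v, p.map φ, ⟨?_, ?_⟩, ?_⟩
  · exact hp.map (Option.map_injective e.symm.injective)
  · intro w hw
    rw [rename_graph_adj] at hw
    have h1 : (φ v).map e = v := hsymm v
    rw [h1] at hw
    rw [SimpleGraph.Walk.support_map]
    refine List.mem_map.2 ⟨_, hmax _ hw, ?_⟩
    change (w.map e).map e.symm = w
    cases w <;> simp
  · rw [SimpleGraph.Walk.length_map]; exact hf

theorem Computes.hasGardenHoseProtocol [Fintype V] {P : GardenHoseProtocol X Y V}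
    {f : X → Y → Bool} (hP : P.Computes f) : HasGardenHoseProtocol f (Fintype.card V) :=
  ⟨P.rename (Fintype.equivFin V).symm, hP.rename _⟩

end GardenHoseProtocol

/-! ### Euler tours of forests -/

namespace EulerTour

variable {ν : Type*} [LinearOrder ν]

/-- The port through which the tour enters a node `v` from above: the descending port of `v`, but
the tap if `v` is the node `start` at which the tour begins. -/
def entry (start v : ν) : Option (ν × Bool) := if v = start then none else some (v, false)

/-- The steps of an Euler tour at a node `v` of a forest, where `C v c` says that `c` is a child of
`v`. The port `(c, false)` stands for the edge above `c` passed downwards, `(c, true)` for that edge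
passed upwards. The children are visited in increasing order. -/
inductive Step (C : ν → ν → Prop) (start v : ν) : Option (ν × Bool) → Option (ν × Bool) → Prop
  | leaf (h : ∀ c, ¬ C v c) : Step C start v (entry start v) (some (v, true))
  | first (c : ν) (hc : C v c) (h : ∀ d, C v d → c ≤ d) :
      Step C start v (entry start v) (some (c, false))
  | next (c c' : ν) (hc : C v c) (hc' : C v c') (hlt : c < c') (h : ∀ d, C v d → c < d → c' ≤ d) :
      Step C start v (some (c, true)) (some (c', false))
  | last (c : ν) (hc : C v c) (h : ∀ d, C v d → d ≤ c) :
      Step C start v (some (c, true)) (some (v, true))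

/-- The forest is graded: children lie one level below their parent, and the tour begins at
level 0. -/
structure Graded (C : ν → ν → Prop) (lev : ν → ℕ) (start : ν) : Prop where
  lev_eq : ∀ v c, C v c → lev v = lev c + 1
  parent_unique : ∀ v v' c, C v c → C v' c → v = v'
  lev_start : lev start = 0

/-- A proper two-colouring of the ports by parity. -/
def colour (lev : ν → ℕ) : Option (ν × Bool) → ℕ
  | none => 1
  | some (v, true) => lev v
  | some (v, false) => lev v + 1

variable {C : ν → ν → Prop} {lev : ν → ℕ} {start : ν}

theorem entry_injective : Function.Injective (entry start) := by
  intro u v h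
  unfold entry at h
  split_ifs at h <;> simp_all

theorem entry_ne_up (u v : ν) : entry start u ≠ some (v, true) := by
  unfold entry; split_ifs <;> simp

theorem colour_entry (hC : Graded C lev start) (v : ν) :
    colour lev (entry start v) = lev v + 1 := by
  unfold entry
  split_ifs with h
  · simp [colour, h, hC.lev_start]
  · rfl

theorem Step.colour_eq (hC : Graded C lev start) {v : ν} {a b : Option (ν × Bool)}
    (h : Step C start v a b) :
    (Even (colour lev a) ↔ ¬ Even (lev v)) ∧ (Even (colour lev b) ↔ Even (lev v)) := by
  cases h with
  | leaf h => rw [colour_entry hC]; simp [colour, Nat.even_add_one]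
  | first c hc h => rw [colour_entry hC]; simp [colour, hC.lev_eq v c hc, Nat.even_add_one]
  | next c c' hc hc' hlt h =>
    have h1 := hC.lev_eq v c hc
    have h2 := hC.lev_eq v c' hc'
    simp only [colour, Nat.even_add_one, h1]
    simp [show lev c' = lev c by omega]
  | last c hc h => simp [colour, hC.lev_eq v c hc, Nat.even_add_one]

theorem Step.ne_none {v : ν} {a : Option (ν × Bool)} : ¬ Step C start v a none := by
  intro h; cases h

theorem Step.functional (hC : Graded C lev start) {v v' : ν} {a b b' : Option (ν × Bool)}
    (h : Step C start v a b) (h' : Step C start v' a b') : b = b' := by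
  generalize ha : a = a' at h'
  cases h with
  | leaf h =>
    cases h' with
    | leaf h' => have := entry_injective ha; simp_all
    | first c hc h' => obtain rfl := entry_injective ha; exact absurd hc (h c)
    | next => exact absurd ha (entry_ne_up _ _)
    | last => exact absurd ha (entry_ne_up _ _)
  | first c hc h =>
    cases h' with
    | leaf h' => obtain rfl := entry_injective ha; exact absurd hc (h' c)
    | first d hd h' =>
      obtain rfl := entry_injective ha
      simp [le_antisymm (h d hd) (h' c hc)]
    | next => exact absurd ha (entry_ne_up _ _)
    | last => exact absurd ha (entry_ne_up _ _)
  | next c c' hc hc' hlt h =>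
    cases h' with
    | leaf => exact absurd ha.symm (entry_ne_up _ _)
    | first => exact absurd ha.symm (entry_ne_up _ _)
    | next d d' hd hd' hlt' h' =>
      obtain rfl : c = d := by simpa using ha
      obtain rfl := hC.parent_unique _ _ _ hc hd
      simp [le_antisymm (h d' hd' hlt') (h' c' hc' hlt)]
    | last d hd h' =>
      obtain rfl : c = d := by simpa using ha
      obtain rfl := hC.parent_unique _ _ _ hc hd
      exact absurd (h' c' hc') (not_le.2 hlt)
  | last c hc h =>
    cases h' with
    | leaf => exact absurd ha.symm (entry_ne_up _ _)
    | first => exact absurd ha.symm (entry_ne_up _ _)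
    | next d d' hd hd' hlt' h' =>
      obtain rfl : c = d := by simpa using ha
      obtain rfl := hC.parent_unique _ _ _ hc hd
      exact absurd (h d' hd') (not_le.2 hlt')
    | last d hd h' =>
      obtain rfl : c = d := by simpa using ha
      obtain rfl := hC.parent_unique _ _ _ hc hd
      simp

theorem Step.injective (hC : Graded C lev start) {v v' : ν} {a a' b : Option (ν × Bool)}
    (h : Step C start v a b) (h' : Step C start v' a' b) : a = a' := by
  generalize hb : b = b' at h'
  cases h with
  | leaf h =>
    cases h' with
    | leaf h' => obtain rfl : v = v' := by simpa using hb
                 rfl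
    | first => simp at hb
    | next => simp at hb
    | last c hc h' =>
      obtain rfl : v = v' := by simpa using hb
      exact absurd hc (h c)
  | first c hc h =>
    cases h' with
    | leaf h' => simp at hb
    | first d hd h' =>
      obtain rfl : c = d := by simpa using hb
      obtain rfl := hC.parent_unique _ _ _ hc hd
      rfl
    | next d d' hd hd' hlt' h' =>
      obtain rfl : c = d' := by simpa using hb
      obtain rfl := hC.parent_unique _ _ _ hc hd'
      exact absurd (h d hd) (not_le.2 hlt')
    | last => simp at hb
  | next c c' hc hc' hlt h =>
    cases h' with
    | leaf => simp at hb
    | first d hd h' =>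
      obtain rfl : c' = d := by simpa using hb
      obtain rfl := hC.parent_unique _ _ _ hc' hd
      exact absurd (h' c hc) (not_le.2 hlt)
    | next d d' hd hd' hlt' h' =>
      obtain rfl : c' = d' := by simpa using hb
      obtain rfl := hC.parent_unique _ _ _ hc' hd'
      -- Two children whose next sibling is `c'` coincide: a smaller one would be followed by
      -- the larger one.
      rcases lt_trichotomy c d with hcd | rfl | hcd
      · exact absurd (h d hd hcd) (not_le.2 hlt')
      · rfl
      · exact absurd (h' c hc hcd) (not_le.2 hlt)
    | last => simp at hb
  | last c hc h =>
    cases h' with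
    | leaf h' =>
      obtain rfl : v = v' := by simpa using hb
      exact absurd hc (h' c)
    | first => simp at hb
    | next => simp at hb
    | last d hd h' =>
      obtain rfl : v = v' := by simpa using hb
      rw [le_antisymm (h' c hc) (h d hd)]

theorem Step.source_up {v u : ν} {b : Option (ν × Bool)} (h : Step C start v (some (u, true)) b) :
    C v u := by
  generalize ha : some (u, true) = a at h
  cases h with
  | leaf => exact absurd ha.symm (entry_ne_up _ _)
  | first => exact absurd ha.symm (entry_ne_up _ _)
  | next c c' hc => obtain rfl : u = c := by simpa using ha
                    exact hc
  | last c hc => obtain rfl : u = c := by simpa using ha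
                 exact hc

section Reach

variable [Finite ν]

/-- After a child of `v` the tour visits the later children and leaves `v` upwards, provided that it
passes completely through each of these. -/
theorem reach_parent {v c : ν} (hc : C v c)
    (hlater : ∀ d, C v d → c < d →
      Relation.ReflTransGen (fun a b => ∃ v, Step C start v a b) (some (d, false)) (some (d, true))) :
    Relation.ReflTransGen (fun a b => ∃ v, Step C start v a b) (some (c, true)) (some (v, true)) := by
  induction c using (Finite.wellFounded_of_trans_of_irrefl (α := ν) (· > ·)).induction with
  | _ c ih =>
    by_cases hlast : ∀ d, C v d → d ≤ c
    · exact .single ⟨v, .last c hc hlast⟩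
    · push Not at hlast
      obtain ⟨d, ⟨hd, hcd⟩, hmin⟩ := Set.exists_min_image {d | C v d ∧ c < d} id
        (Set.toFinite _) hlast
      refine .head ⟨v, .next c d hc hd hcd fun e he hce => hmin e ⟨he, hce⟩⟩ ?_
      exact (hlater d hd hcd).trans (ih d hcd hd fun e he hde => hlater e he (hcd.trans hde))

/-- The tour passes completely through the subtree of any node that is not an ancestor `anc i` of
the starting node. -/
theorem reach_up_of_not_ancestor (hC : Graded C lev start) {D : ℕ} {anc : ℕ → ν}
    (hstart : anc 0 = start) (hanc : ∀ i < D, C (anc (i + 1)) (anc i))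
    (hroot : ∀ v, ¬ C v (anc D)) {v : ν} (hv : ∀ i ≤ D, v ≠ anc i) :
    Relation.ReflTransGen (fun a b => ∃ v, Step C start v a b) (some (v, false)) (some (v, true)) := by
  induction hl : lev v using Nat.strong_induction_on generalizing v with
  | _ l ih =>
    have hentry : entry start v = some (v, false) := by
      rw [entry, if_neg]; rw [← hstart]; exact hv 0 (Nat.zero_le _)
    have hchild : ∀ c, C v c → Relation.ReflTransGen (fun a b => ∃ v, Step C start v a b)
        (some (c, false)) (some (c, true)) := by
      intro c hc
      refine ih (lev c) (by have := hC.lev_eq v c hc; omega) (fun i hi => ?_) rfl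
      rintro rfl
      rcases hi.lt_or_eq with hi | rfl
      · exact hv (i + 1) hi (hC.parent_unique _ _ _ hc (hanc i hi))
      · exact hroot v hc
    by_cases hleaf : ∀ c, ¬ C v c
    · have := Step.leaf (start := start) hleaf
      rw [hentry] at this
      exact .single ⟨v, this⟩
    · push Not at hleaf
      obtain ⟨c, hc, hmin⟩ := Set.exists_min_image {c | C v c} id (Set.toFinite _) hleaf
      have := Step.first (start := start) c hc hmin
      rw [hentry] at this
      exact .head ⟨v, this⟩ ((hchild c hc).trans (reach_parent hc fun d hd _ => hchild d hd))

/-- The tour that begins at `start` leaves all ancestors of `start` upwards. -/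
theorem reach_up_ancestor (hC : Graded C lev start) {D : ℕ} {anc : ℕ → ν}
    (hstart : anc 0 = start) (hanc : ∀ i < D, C (anc (i + 1)) (anc i))
    (hroot : ∀ v, ¬ C v (anc D)) {i : ℕ} (hi : i ≤ D) :
    Relation.ReflTransGen (fun a b => ∃ v, Step C start v a b) none (some (anc i, true)) := by
  have hlev : ∀ i ≤ D, lev (anc i) = i := by
    intro i hi
    induction i with
    | zero => rw [hstart, hC.lev_start]
    | succ i ih => rw [hC.lev_eq _ _ (hanc i hi), ih (by omega)]
  induction i with
  | zero =>
    have hleaf : ∀ c, ¬ C start c := fun c hc => by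
      have := hC.lev_eq _ _ hc
      rw [hC.lev_start] at this; omega
    have := Step.leaf (start := start) hleaf
    rw [entry, if_pos rfl] at this
    rw [hstart]
    exact .single ⟨start, this⟩
  | succ i ih =>
    refine (ih (by omega)).trans (reach_parent (hanc i hi) fun d hd hlt => ?_)
    refine reach_up_of_not_ancestor hC hstart hanc hroot fun k hk => ?_
    rintro rfl
    have h1 := hC.lev_eq _ _ hd
    rw [hlev _ hi, hlev _ hk] at h1
    obtain rfl : k = i := by omega
    exact lt_irrefl _ hlt

end Reach

end EulerTour

/-! ### The protocol of a layered computation -/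

namespace EulerTour

section Halves

variable {ν : Type*} [LinearOrder ν] {C C' : ν → ν → Prop} {lev : ν → ℕ} {start : ν}

theorem Step.congr {v : ν} (hCC : ∀ c, C v c ↔ C' v c) {a b : Option (ν × Bool)}
    (h : Step C start v a b) : Step C' start v a b := by
  cases h with
  | leaf h => exact .leaf fun c hc => h c ((hCC c).2 hc)
  | first c hc h => exact .first c ((hCC c).1 hc) fun d hd => h d ((hCC d).2 hd)
  | next c c' hc hc' hlt h =>
    exact .next c c' ((hCC c).1 hc) ((hCC c').1 hc') hlt fun d hd => h d ((hCC d).2 hd)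
  | last c hc h => exact .last c ((hCC c).1 hc) fun d hd => h d ((hCC d).2 hd)

theorem step_congr {v : ν} (hCC : ∀ c, C v c ↔ C' v c) {a b : Option (ν × Bool)} :
    Step C start v a b ↔ Step C' start v a b :=
  ⟨.congr hCC, .congr fun c => (hCC c).symm⟩

theorem Step.ne (hC : Graded C lev start) {v : ν} {a b : Option (ν × Bool)}
    (h : Step C start v a b) : a ≠ b := by
  rintro rfl
  have := h.colour_eq hC
  tauto

/-- The steps of the Euler tour at the nodes whose level has parity `e`, as undirected edges. -/
def half (hC : Graded C lev start) (e : Bool) : SimpleGraph (Option (ν × Bool)) where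
  Adj a b := ∃ v, (Even (lev v) ↔ e) ∧ (Step C start v a b ∨ Step C start v b a)
  symm.symm _ _ := fun ⟨v, hv, h⟩ => ⟨v, hv, h.symm⟩
  loopless.irrefl _ := fun ⟨_, _, h⟩ => (h.elim id id).ne hC rfl

/-- The steps at the nodes of one parity form a matching: they lead from ports of one colour to
ports of the other colour, and the step relation is a partial injection. -/
theorem half_matching (hC : Graded C lev start) (e : Bool) :
    (half hC e).EdgesFormMatching := by
  rintro a b c ⟨v, hv, h⟩ ⟨w, hw, h'⟩
  rcases h with h | h <;> rcases h' with h' | h'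
  · exact h.functional hC h'
  · have h1 := h.colour_eq hC
    have h2 := h'.colour_eq hC
    tauto
  · have h1 := h.colour_eq hC
    have h2 := h'.colour_eq hC
    tauto
  · exact h.injective hC h'

end Halves

section Layers

variable {X Y τ : Type*} {N : ℕ}

/-- The forest of a layered computation: the node `(t, s)` is state `s` at time `t`, and its parent
is the state that `step t` leads to, if there is one. -/
def child (step : ℕ → τ → Option τ) (v c : Fin N ×ₗ τ) : Prop :=
  ((ofLex v).1 : ℕ) = (ofLex c).1 + 1 ∧ step (ofLex c).1 (ofLex c).2 = some (ofLex v).2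

theorem graded_child (step : ℕ → τ → Option τ) (hN : 0 < N) (s₀ : τ) :
    Graded (child (N := N) step) (fun v => (ofLex v).1) (toLex (⟨0, hN⟩, s₀)) where
  lev_eq v c h := h.1
  parent_unique v v' c h h' := by
    apply ofLex.injective
    apply Prod.ext
    · exact Fin.ext (h.1.trans h'.1.symm)
    · exact Option.some.inj (h.2.symm.trans h'.2)
  lev_start := rfl

variable [LinearOrder τ]

/-- The garden-hose protocol that lets the water run along an Euler tour of the forest of a layered
computation in which Bob performs the steps at even times and Alice those at odd times. -/
def protocol (A : ℕ → X → τ → Option τ) (B : ℕ → Y → τ → Option τ) (hN : 0 < N) (s₀ : τ) :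
    GardenHoseProtocol X Y ((Fin N ×ₗ τ) × Bool) where
  alice x := half (graded_child (fun t => A t x) hN s₀) true
  bob y := (half (graded_child (fun t => B t y) hN s₀) false).comap some
  alice_matching _ := half_matching _ _
  bob_matching y _ _ _ h h' := Option.some.inj
    (half_matching (graded_child (fun t => B t y) hN s₀) false _ _ _ h h')

theorem protocol_graph_adj (A : ℕ → X → τ → Option τ) (B : ℕ → Y → τ → Option τ) (hN : 0 < N)
    (s₀ : τ) (x : X) (y : Y) (a b : Option ((Fin N ×ₗ τ) × Bool)) :
    ((protocol A B hN s₀).graph x y).Adj a b ↔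
      (∃ v, Step (child fun t => if Even t then B t y else A t x) (toLex (⟨0, hN⟩, s₀)) v a b) ∨
      ∃ v, Step (child fun t => if Even t then B t y else A t x) (toLex (⟨0, hN⟩, s₀)) v b a := by
  have hA : ∀ v : Fin N ×ₗ τ, Even ((ofLex v).1 : ℕ) → ∀ c, child (fun t => A t x) v c ↔
      child (fun t => if Even t then B t y else A t x) v c := by
    intro v hv c
    unfold child
    refine and_congr_right fun h => ?_
    beta_reduce
    rw [if_neg]
    intro hc
    rw [h, Nat.even_add_one] at hv
    exact hv hc
  have hB : ∀ v : Fin N ×ₗ τ, ¬ Even ((ofLex v).1 : ℕ) → ∀ c, child (fun t => B t y) v c ↔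
      child (fun t => if Even t then B t y else A t x) v c := by
    intro v hv c
    unfold child
    refine and_congr_right fun h => ?_
    beta_reduce
    rw [if_pos]
    rwa [h, Nat.even_add_one, not_not] at hv
  have hbob : ∀ a b, (((protocol A B hN s₀).bob y).map some).Adj a b ↔
      (half (graded_child (fun t => B t y) hN s₀) false).Adj a b := by
    intro a b
    constructor
    · rintro ⟨-, u, v, h, rfl, rfl⟩
      exact h
    · -- The tap takes no part in the steps at nodes of odd level.
      have hne : ∀ a b v, ¬ Even ((ofLex v).1 : ℕ) →
          Step (child (N := N) fun t => B t y) (toLex (⟨0, hN⟩, s₀)) v a b → a ≠ none := by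
        rintro a b v hv h rfl
        have := (h.colour_eq (graded_child _ hN s₀)).1
        simp [colour, hv] at this
      intro h
      refine ⟨h.ne, ?_⟩
      have h0 := h
      obtain ⟨v, hv, h⟩ := h
      have hv : ¬ Even ((ofLex v).1 : ℕ) := by simpa using hv
      have hab : a ≠ none ∧ b ≠ none := by
        rcases h with h | h
        · exact ⟨hne _ _ _ hv h, by rintro rfl; exact h.ne_none⟩
        · exact ⟨by rintro rfl; exact h.ne_none, hne _ _ _ hv h⟩
      obtain ⟨u, rfl⟩ := Option.ne_none_iff_exists'.1 hab.1
      obtain ⟨w, rfl⟩ := Option.ne_none_iff_exists'.1 hab.2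
      exact ⟨u, w, h0, rfl, rfl⟩
  change ((protocol A B hN s₀).alice x).Adj a b ∨
    (((protocol A B hN s₀).bob y).map some).Adj a b ↔ _
  rw [hbob]
  constructor
  · rintro (⟨v, hv, h⟩ | ⟨v, hv, h⟩)
    · have hv : Even ((ofLex v).1 : ℕ) := by simpa using hv
      exact h.imp (fun h => ⟨v, h.congr (hA v hv)⟩) (fun h => ⟨v, h.congr (hA v hv)⟩)
    · have hv : ¬ Even ((ofLex v).1 : ℕ) := by simpa using hv
      exact h.imp (fun h => ⟨v, h.congr (hB v hv)⟩) (fun h => ⟨v, h.congr (hB v hv)⟩)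
  · rw [← exists_or]
    rintro ⟨v, h⟩
    by_cases hv : Even ((ofLex v).1 : ℕ)
    · exact .inl ⟨v, by simpa using hv, by rwa [step_congr (hA v hv), step_congr (hA v hv)]⟩
    · exact .inr ⟨v, by simpa using hv, by rwa [step_congr (hB v hv), step_congr (hB v hv)]⟩

/-- The water reaches the root above the starting state, and the parity of its time decides on
which side it spills. -/
theorem protocol_computes [Finite τ] {A : ℕ → X → τ → Option τ} {B : ℕ → Y → τ → Option τ}
    {hN : 0 < N} {s₀ : τ} {f : X → Y → Bool}
    (H : ∀ x y, ∃ D < N, ∃ st : ℕ → τ, st 0 = s₀ ∧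
      (∀ i < D, (if Even i then B i y else A i x) (st i) = some (st (i + 1))) ∧
      (if Even D then B D y else A D x) (st D) = none ∧ (Even D ↔ f x y = true)) :
    (protocol A B hN s₀).Computes f := by
  intro x y
  obtain ⟨D, hD, st, h0, hst, hend, hf⟩ := H x y
  set C : Fin N ×ₗ τ → Fin N ×ₗ τ → Prop := child fun t => if Even t then B t y else A t x
    with hC_def
  set start : Fin N ×ₗ τ := toLex (⟨0, hN⟩, s₀)
  have hC : Graded C (fun v => (ofLex v).1) start := graded_child _ hN s₀
  let anc : ℕ → Fin N ×ₗ τ := fun i => toLex (⟨min i D, by omega⟩, st i)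
  have hroot : ∀ v, ¬ C v (anc D) := by
    rintro v ⟨-, h⟩
    simp [anc, hend] at h
  have hanc : ∀ i < D, C (anc (i + 1)) (anc i) := by
    intro i hi
    refine ⟨?_, ?_⟩
    · simp only [anc, ofLex_toLex]; omega
    · simp only [anc, ofLex_toLex, Nat.min_eq_left hi.le]
      exact hst i hi
  have hstart : anc 0 = start := by simp [anc, start, h0]
  have : Finite (Fin N ×ₗ τ) := inferInstanceAs (Finite (Fin N × τ))
  have hadj := protocol_graph_adj A B hN s₀ x y
  obtain ⟨p, hp, hmax⟩ := SimpleGraph.exists_maximal_path_of_reflTransGen hadj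
    (fun u v w ⟨_, hu⟩ ⟨_, hv⟩ => hu.injective hC hv) (fun u ⟨_, hu⟩ => hu.ne_none)
    (reach_up_ancestor hC hstart hanc hroot le_rfl)
    (fun u ⟨v, hv⟩ => hroot v hv.source_up)
  refine ⟨_, p, ⟨hp, hmax⟩, ?_⟩
  let col : ((protocol A B hN s₀).graph x y).Coloring Bool :=
    ⟨fun a => decide (Even (colour (fun v => ((ofLex v).1 : ℕ)) a)), by
      intro a b hab
      rw [SimpleGraph.top_adj, ne_eq, decide_eq_decide]
      rcases (hadj a b).1 hab with ⟨v, h⟩ | ⟨v, h⟩ <;>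
      · have := h.colour_eq hC
        tauto⟩
  rw [col.even_length_iff_congr p]
  change (decide (Even 1) = true ↔ decide (Even (min D D)) = true) ↔ _
  rw [← Bool.not_eq_true, ← hf]
  simp

end Layers

end EulerTour

/-- A computation in which Bob and Alice alternately update a state from `τ`, stopping before time
`N`, is carried out by a garden-hose protocol: `f` is to be 1 if and only if the computation stops
at an even time. The updates need not be injective. -/
theorem hasGardenHoseProtocol_of_layers {X Y τ : Type*} [Fintype τ] {N : ℕ} (hN : 0 < N)
    (A : ℕ → X → τ → Option τ) (B : ℕ → Y → τ → Option τ) (s₀ : τ) (f : X → Y → Bool)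
    (H : ∀ x y, ∃ D < N, ∃ st : ℕ → τ, st 0 = s₀ ∧
      (∀ i < D, (if Even i then B i y else A i x) (st i) = some (st (i + 1))) ∧
      (if Even D then B D y else A D x) (st D) = none ∧ (Even D ↔ f x y = true)) :
    HasGardenHoseProtocol f (2 * (N * Fintype.card τ)) := by
  let : LinearOrder τ := LinearOrder.lift' (Fintype.equivFin τ) (Fintype.equivFin τ).injective
  let : Fintype (Fin N ×ₗ τ) := inferInstanceAs (Fintype (Fin N × τ))
  have := (EulerTour.protocol_computes (hN := hN) H).hasGardenHoseProtocol
  have hcard : Fintype.card ((Fin N ×ₗ τ) × Bool) = 2 * (N * Fintype.card τ) := by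
    rw [Fintype.card_prod, Fintype.card_bool, mul_comm]
    congr 1
    exact (Fintype.card_prod (Fin N) τ).trans (by rw [Fintype.card_fin])
  rwa [hcard] at this

/-! ### Branching programs -/

/-- An instruction of an oblivious branching program with state set `σ`: the conjunction of a bit
known to Alice and a bit known to Bob selects the update of the state. -/
structure AndStep (X Y σ : Type*) where
  alice : X → Bool
  bob : Y → Bool
  update : Bool → σ → σ

namespace AndStep

variable {X Y σ : Type*}

/-- The effect of an instruction on the state. -/
def run (x : X) (y : Y) (s : σ) (c : AndStep X Y σ) : σ := c.update (c.alice x && c.bob y) s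

/-- The effect of a program, that is, of a list of instructions. -/
def eval (P : List (AndStep X Y σ)) (x : X) (y : Y) (s : σ) : σ := P.foldl (run x y) s

theorem eval_append (P Q : List (AndStep X Y σ)) (x : X) (y : Y) (s : σ) :
    eval (P ++ Q) x y s = eval Q x y (eval P x y s) := List.foldl_append

/-- A program is turned into a garden-hose protocol whose size is linear in the number of
instructions and in the number of states. For each instruction Bob records his bit in the state,
then Alice performs the update; a last step of Bob lets the rejected states run on by one step. -/
theorem hasGardenHoseProtocol [Fintype σ] (P : List (AndStep X Y σ)) (s₀ : σ) (accept : σ → Bool)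
    {f : X → Y → Bool} (hf : ∀ x y, f x y = accept (eval P x y s₀)) :
    HasGardenHoseProtocol f (8 * (P.length + 1) * Fintype.card σ) := by
  let c : ℕ → AndStep X Y σ := fun i =>
    P.getD i ⟨fun _ => false, fun _ => false, fun _ s => s⟩
  let B : ℕ → Y → σ × Bool → Option (σ × Bool) := fun t y s =>
    if t < 2 * P.length then some (s.1, (c (t / 2)).bob y)
    else if accept s.1 then none else some s
  let A : ℕ → X → σ × Bool → Option (σ × Bool) := fun t x s =>
    if t < 2 * P.length then some ((c (t / 2)).update ((c (t / 2)).alice x && s.2) s.1, false)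
    else none
  have := hasGardenHoseProtocol_of_layers (N := 2 * P.length + 2) (by omega) A B (s₀, false) f ?_
  · have hcard : 2 * ((2 * P.length + 2) * Fintype.card (σ × Bool)) =
        8 * (P.length + 1) * Fintype.card σ := by
      rw [Fintype.card_prod, Fintype.card_bool]; ring
    rwa [hcard] at this
  · intro x y
    let st : ℕ → σ × Bool := fun t =>
      if Even t then (eval (P.take (t / 2)) x y s₀, false)
      else if t < 2 * P.length then (eval (P.take (t / 2)) x y s₀, (c (t / 2)).bob y)
      else (eval P x y s₀, false)
    have hlast : st (2 * P.length) = (eval P x y s₀, false) := by simp [st]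
    have hrun : ∀ i < 2 * P.length,
        (if Even i then B i y else A i x) (st i) = some (st (i + 1)) := by
      intro i hi
      rcases Nat.even_or_odd' i with ⟨k, rfl | rfl⟩
      · have h1 : (2 * k + 1) / 2 = k := by omega
        have h2 : 2 * k + 1 < 2 * P.length := by omega
        simp [st, B, hi, h1, h2]
      · have h1 : (2 * k + 1) / 2 = k := by omega
        have h2 : (2 * k + 1 + 1) / 2 = k + 1 := by omega
        have h3 : Even (2 * k + 1 + 1) := ⟨k + 1, by ring⟩
        have h4 : k < P.length := by omega
        have h5 : c k = P[k] := by simp [c, h4]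
        have h6 : eval (P.take (k + 1)) x y s₀ = run x y (eval (P.take k) x y s₀) P[k] := by
          rw [List.take_succ_eq_append_getElem h4, eval_append]; rfl
        simp only [st, A, hi, h1, h2, h3, h5, h6, if_true, if_false, Nat.not_even_bit1]
        rfl
    by_cases hacc : f x y = true
    · refine ⟨2 * P.length, by omega, st, by simp [st, eval], hrun, ?_, by simp [hacc]⟩
      simp [hlast, B, ← hf, hacc]
    · refine ⟨2 * P.length + 1, by omega, st, by simp [st, eval], ?_, by simp [A], by simp [hacc]⟩
      intro i hi
      rcases (Nat.lt_succ_iff.1 hi).lt_or_eq with hi | rfl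
      · exact hrun i hi
      · rw [hlast]
        simp [st, B, ← hf, hacc]

end AndStep

/-! ### Partial fractions with small denominators -/

/-- Partial fractions: the inverse of a product of pairwise coprime numbers is an integral
combination of their inverses. -/
theorem exists_sum_div_eq_one_div_prod {ι : Type*} (s : Finset ι) (q : ι → ℕ)
    (hs : s.Nonempty) (hq : ∀ i ∈ s, q i ≠ 0)
    (hcop : (s : Set ι).Pairwise fun i j => (q i).Coprime (q j)) :
    ∃ a : ι → ℤ, ∑ i ∈ s, (a i : ℚ) / q i = 1 / (∏ i ∈ s, q i : ℕ) := by
  classical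
  induction hs using Finset.Nonempty.cons_induction with
  | singleton i => exact ⟨1, by simp⟩
  | cons i s hi hs ih =>
    rw [Finset.cons_eq_insert] at *
    obtain ⟨a, ha⟩ := ih (fun j hj => hq j (Finset.mem_insert_of_mem hj))
      (hcop.mono (by simp))
    have hc : (q i).Coprime (∏ j ∈ s, q j) := Nat.Coprime.prod_right fun j hj =>
      hcop (by simp) (by simp [hj]) (by rintro rfl; exact hi hj)
    obtain ⟨u, v, huv⟩ := Nat.isCoprime_iff_coprime.2 hc
    refine ⟨fun j => if j = i then v else u * a j, ?_⟩
    rw [Finset.sum_insert hi, Finset.prod_insert hi]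
    beta_reduce
    rw [if_pos rfl]
    have h1 : ∑ j ∈ s, ((if j = i then v else u * a j : ℤ) : ℚ) / q j =
        u * ∑ j ∈ s, (a j : ℚ) / q j := by
      rw [Finset.mul_sum]
      refine Finset.sum_congr rfl fun j hj => ?_
      rw [if_neg (by rintro rfl; exact hi hj)]
      push_cast; ring
    rw [h1, ha]
    have hqi : (q i : ℚ) ≠ 0 := by exact_mod_cast hq i (by simp)
    have hqs : ((∏ j ∈ s, q j : ℕ) : ℚ) ≠ 0 := by
      exact_mod_cast Finset.prod_ne_zero_iff.2 fun j hj => hq j (by simp [hj])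
    have huv' : (u : ℚ) * q i + v * (∏ j ∈ s, q j : ℕ) = 1 := by exact_mod_cast huv
    generalize (∏ j ∈ s, q j) = Q at *
    push_cast
    field_simp
    linarith

/-- The inverse of a central binomial coefficient is a short sum of fractions with small
denominators, since the prime powers that divide `m.centralBinom` are at most `2 * m`. -/
theorem exists_list_sum_eq_one_div_centralBinom {m : ℕ} (hm : 0 < m) :
    ∃ l : List (ℕ × ℤ), l.length ≤ 2 * m ∧ (∀ d ∈ l, 0 < d.1 ∧ d.1 ≤ 2 * m) ∧
      (l.map fun d => (d.2 : ℚ) / d.1).sum = 1 / m.centralBinom := by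
  set L := m.centralBinom with hL
  have hq : ∀ p, p ^ L.factorization p ≤ 2 * m := fun p => by
    rw [hL, Nat.centralBinom_eq_two_mul_choose]
    exact Nat.pow_factorization_choose_le (by omega)
  obtain ⟨a, ha⟩ := exists_sum_div_eq_one_div_prod L.primeFactors (fun p => p ^ L.factorization p)
    (Nat.nonempty_primeFactors.2 (Nat.two_le_centralBinom m hm))
    (fun p hp => pow_ne_zero _ (Nat.prime_of_mem_primeFactors hp).ne_zero)
    (fun p hp p' hp' hne => Nat.coprime_pow_primes _ _ (Nat.prime_of_mem_primeFactors hp)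
      (Nat.prime_of_mem_primeFactors hp') hne)
  have hprod : ∏ p ∈ L.primeFactors, p ^ L.factorization p = L :=
    Nat.prod_factorization_pow_eq_self (Nat.centralBinom_ne_zero m)
  refine ⟨L.primeFactors.toList.map fun p => (p ^ L.factorization p, a p), ?_, ?_, ?_⟩
  · rw [List.length_map, Finset.length_toList]
    have hsub : L.primeFactors ⊆ Finset.Icc 1 (2 * m) := by
      intro p hp
      have hpp := Nat.prime_of_mem_primeFactors hp
      refine Finset.mem_Icc.2 ⟨hpp.one_le, le_trans ?_ (hq p)⟩
      refine Nat.le_self_pow ?_ p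
      exact (hpp.factorization_pos_of_dvd (Nat.centralBinom_ne_zero m)
        (Nat.dvd_of_mem_primeFactors hp)).ne'
    simpa using Finset.card_le_card hsub
  · intro d hd
    obtain ⟨p, hp, rfl⟩ := List.mem_map.1 hd
    have hpp := Nat.prime_of_mem_primeFactors (Finset.mem_toList.1 hp)
    exact ⟨pow_pos hpp.pos _, hq p⟩
  · rw [hprod] at ha
    rw [← ha, List.map_map, ← Finset.sum_map_toList]
    rfl

/-! ### The program for Majority -/

namespace Majority

open AndStep

/-- The number of common ones of `x` and `y`. -/
def common {n : ℕ} (x y : Fin n → Bool) : ℕ := ∑ i, (x i && y i).toNat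

/-- The states of the program for Majority: a verdict or the value of a counter. -/
abbrev State (w : ℕ) : Type := Bool ⊕ Fin w

section Programs

variable {n : ℕ} (w K : ℕ) [NeZero w]

/-- An instruction that leaves verdicts alone and updates the counter. Truncation of the counter to
`Fin w` plays no role, as all programs below keep it less than `w`. -/
def counterStep {X Y : Type*} (a : X → Bool) (b : Y → Bool) (f : Bool → ℕ → ℕ) :
    AndStep X Y (State w) where
  alice := a
  bob := b
  update r := Sum.map id fun z => Fin.ofNat w (f r z)

/-- Add `e` times the number of common ones to the counter, modulo `W`. -/
def countPass (W e : ℕ) : List (AndStep (Fin n → Bool) (Fin n → Bool) (State w)) :=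
  (List.finRange n).map fun i =>
    counterStep w (fun x => x i) (fun y => y i) fun r z => (z + e * r.toNat) % W

/-- The least multiple of `q` that exceeds `K`. -/
def gridSize (q : ℕ) : ℕ := q * (K / q + 1)

/-- The amount that a common one adds to a counter modulo `gridSize K q`, so that the quotient
of the counter and the modulus grows by `a / q` modulo one. -/
def increment (q : ℕ) (a : ℤ) : ℕ := (a * ((K / q + 1 : ℕ) : ℤ) % (gridSize K q : ℤ)).toNat

/-- Starting from a counter modulo `W₀`, add for each entry `(q, a)` of the list `a / q` times the
number of common ones to the quotient of the counter and the modulus. Before each of these passes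
the counter is rescaled to the new modulus. -/
def phase : ℕ → List (ℕ × ℤ) → List (AndStep (Fin n → Bool) (Fin n → Bool) (State w))
  | _, [] => []
  | W₀, d :: l =>
    counterStep w (fun _ => false) (fun _ => false) (fun _ z => z * gridSize K d.1 / W₀) ::
      (countPass w (gridSize K d.1) (increment K d.1 d.2) ++ phase (gridSize K d.1) l)

/-- The modulus of the counter after `phase`. -/
def lastModulus : ℕ → List (ℕ × ℤ) → ℕ
  | W₀, [] => W₀
  | _, d :: l => lastModulus (gridSize K d.1) l

variable {w K}

theorem eval_countPass {W e : ℕ} (hW : W ≤ w) (x y : Fin n → Bool) {z : Fin w}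
    (hz : (z : ℕ) < W) :
    ∃ z' : Fin w, eval (countPass w W e) x y (.inr z) = .inr z' ∧
      (z' : ℕ) = (z + e * common x y) % W := by
  have key : ∀ (l : List (Fin n)) (z : Fin w), (z : ℕ) < W → ∃ z' : Fin w,
      eval (l.map fun i => counterStep w (fun x => x i) (fun y => y i)
        fun r z => (z + e * r.toNat) % W) x y (.inr z) = .inr z' ∧
      (z' : ℕ) = (z + e * (l.map fun i => (x i && y i).toNat).sum) % W := by
    intro l
    induction l with
    | nil => intro z hz; exact ⟨z, rfl, by simp [Nat.mod_eq_of_lt hz]⟩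
    | cons i l ih =>
      intro z hz
      have hlt : (z + e * (x i && y i).toNat) % W < W := Nat.mod_lt _ (by omega)
      have hval : ((Fin.ofNat w ((z + e * (x i && y i).toNat) % W) : Fin w) : ℕ) =
          (z + e * (x i && y i).toNat) % W := by
        rw [Fin.val_ofNat, Nat.mod_eq_of_lt (hlt.trans_le hW)]
      obtain ⟨z', h1, h2⟩ := ih (Fin.ofNat w ((z + e * (x i && y i).toNat) % W)) (by rwa [hval])
      refine ⟨z', h1, ?_⟩
      rw [h2, hval, Nat.mod_add_mod, List.map_cons, List.sum_cons, mul_add, add_assoc]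
  obtain ⟨z', h1, h2⟩ := key (List.finRange n) z hz
  refine ⟨z', h1, ?_⟩
  rw [h2, common, ← List.ofFn_eq_map, List.sum_ofFn]

/-- Each pass of a phase contributes an error of at most `1 / K`, caused by the rescaling of the
counter; the count itself is exact. -/
theorem eval_phase (hK : 0 < K) (x y : Fin n → Bool) (l : List (ℕ × ℤ))
    (hl : ∀ d ∈ l, 0 < d.1 ∧ gridSize K d.1 ≤ w) {W₀ : ℕ} {z : Fin w} (hz : (z : ℕ) < W₀) :
    ∃ (z' : Fin w) (N : ℤ) (δ : ℚ), eval (phase w K W₀ l) x y (.inr z) = .inr z' ∧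
      0 ≤ δ ∧ δ ≤ l.length / K ∧
      (z' : ℚ) / lastModulus K W₀ l =
        z / W₀ + common x y * (l.map fun d => (d.2 : ℚ) / d.1).sum + N - δ := by
  induction l generalizing W₀ z with
  | nil => exact ⟨z, 0, 0, rfl, le_rfl, by simp, by simp [lastModulus]⟩
  | cons d l ih =>
    obtain ⟨q, a⟩ := d
    obtain ⟨hq, hW⟩ := hl (q, a) (by simp)
    simp only at hq hW
    have hlarge : K < gridSize K q := by
      have := Nat.lt_div_mul_add hq (a := K)
      unfold gridSize; nlinarith
    set W := gridSize K q with hWdef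
    have hWpos : 0 < W := by omega
    have hW₀ : 0 < W₀ := by omega
    set u : ℕ := z * W / W₀ with hu
    have huW : u < W := Nat.div_lt_of_lt_mul (Nat.mul_lt_mul_of_pos_right hz hWpos)
    have hval : ((Fin.ofNat w u : Fin w) : ℕ) = u := by
      rw [Fin.val_ofNat, Nat.mod_eq_of_lt (huW.trans_le hW)]
    obtain ⟨z₁, h1, h1'⟩ := eval_countPass (e := increment K q a) hW x y
      (z := Fin.ofNat w u) (by rwa [hval])
    rw [hval] at h1'
    have hz₁ : (z₁ : ℕ) < W := by rw [h1']; exact Nat.mod_lt _ hWpos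
    obtain ⟨z', N, δ, h2, hδ0, hδ1, h2'⟩ := ih (fun d hd => hl d (by simp [hd])) hz₁
    have hWq : (0 : ℚ) < W := by exact_mod_cast hWpos
    have hW₀q : (0 : ℚ) < W₀ := by exact_mod_cast hW₀
    have hKq : (0 : ℚ) < K := by exact_mod_cast hK
    have hqq : (0 : ℚ) < q := by exact_mod_cast hq
    -- The rescaling loses less than one unit of the new grid.
    have hδ : 0 ≤ (z : ℚ) / W₀ - u / W ∧ (z : ℚ) / W₀ - u / W ≤ 1 / K := by
      have e1 : (u : ℚ) * W₀ ≤ z * W := by exact_mod_cast Nat.div_mul_le_self _ _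
      have e2 : (z : ℚ) * W ≤ u * W₀ + W₀ := by
        exact_mod_cast (Nat.lt_div_mul_add hW₀ (a := z * W)).le
      constructor
      · rw [sub_nonneg, div_le_div_iff₀ hWq hW₀q]; exact e1
      · have : (z : ℚ) / W₀ ≤ u / W + 1 / W := by
          rw [← add_div, div_le_div_iff₀ hW₀q hWq]; linarith
        have : (1 : ℚ) / W ≤ 1 / K :=
          one_div_le_one_div_of_le hKq (by exact_mod_cast hlarge.le)
        linarith
    have hinc : ∃ M : ℤ, (increment K q a : ℚ) / W = a / q + M := by
      refine ⟨-(a * ((K / q + 1 : ℕ) : ℤ) / (W : ℤ)), ?_⟩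
      have e1 : (increment K q a : ℤ) = a * ((K / q + 1 : ℕ) : ℤ) -
          W * (a * ((K / q + 1 : ℕ) : ℤ) / (W : ℤ)) := by
        rw [increment, Int.toNat_of_nonneg (Int.emod_nonneg _ (by omega)), Int.emod_def]
      have e2 : (increment K q a : ℚ) = a * ((K / q + 1 : ℕ) : ℚ) -
          W * ((a * ((K / q + 1 : ℕ) : ℤ) / (W : ℤ) : ℤ) : ℚ) := by
        have := congrArg (Int.cast : ℤ → ℚ) e1
        push_cast at this ⊢; exact this
      have e3 : (W : ℚ) = q * ((K / q + 1 : ℕ) : ℚ) := by rw [hWdef, gridSize]; push_cast; ring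
      have e4 : ((K / q + 1 : ℕ) : ℚ) ≠ 0 := by positivity
      rw [e2, sub_div, mul_div_cancel_left₀ _ hWq.ne']
      rw [e3, mul_div_mul_right _ _ e4]
      push_cast; ring
    obtain ⟨M, hM⟩ := hinc
    have hz₁' : ∃ N₁ : ℤ, (z₁ : ℚ) / W = u / W + common x y * (a / q) + N₁ := by
      refine ⟨common x y * M - (((u + increment K q a * common x y) / W : ℕ) : ℤ), ?_⟩
      have e1 := Nat.mod_add_div (u + increment K q a * common x y) W
      rw [← h1'] at e1
      have e2 : (z₁ : ℚ) + W * ((u + increment K q a * common x y) / W : ℕ) =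
          u + increment K q a * common x y := by exact_mod_cast e1
      have e3 : (z₁ : ℚ) = u + increment K q a * common x y -
          W * ((u + increment K q a * common x y) / W : ℕ) := by linarith
      rw [e3, sub_div, add_div, mul_div_cancel_left₀ _ hWq.ne', mul_div_right_comm, hM, Int.cast_sub, Int.cast_natCast]
      push_cast; ring
    obtain ⟨N₁, hN₁⟩ := hz₁'
    refine ⟨z', N + N₁, δ + (z / W₀ - u / W), ?_, by linarith, ?_, ?_⟩
    · rw [phase, ← List.singleton_append, eval_append, eval_append, ← h2, ← h1]
      rfl
    · rw [List.length_cons]; push_cast; rw [add_div]; linarith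
    · rw [lastModulus, ← hWdef, h2', hN₁, List.map_cons, List.sum_cons]
      push_cast; ring

variable (w) in
/-- Test the position of `z / W + β` modulo one, where `z` is the counter: a value clearly above or
below 0 gives a verdict, otherwise the counter is reset. -/
noncomputable def testStep (X Y : Type*) (W : ℕ) (β : ℚ) : AndStep X Y (State w) where
  alice _ := false
  bob _ := false
  update _ := Sum.elim .inl fun z =>
    if 1 / 16 ≤ ((z : ℚ) / W + β) - round ((z : ℚ) / W + β) then .inl true
    else if ((z : ℚ) / W + β) - round ((z : ℚ) / W + β) < -(1 / 16) then .inl false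
    else .inr 0

variable (w K) in
/-- Estimate `S * ∑ a / q + β` modulo one, where `S` is the number of common ones, and test the
result. -/
noncomputable def testRound (l : List (ℕ × ℤ)) (β : ℚ) :
    List (AndStep (Fin n → Bool) (Fin n → Bool) (State w)) :=
  phase w K 1 l ++ [testStep w _ _ (lastModulus K 1 l) β]

/-- One round of the program. The estimate errs by at most `1 / 16` and only downwards, so a
verdict agrees with the sign of `v`; without a verdict `2 * v` satisfies the bounds assumed of `v`. -/
theorem eval_testRound (hK : 0 < K) (x y : Fin n → Bool) {l : List (ℕ × ℤ)}
    (hl : ∀ d ∈ l, 0 < d.1 ∧ gridSize K d.1 ≤ w) (hlen : 16 * l.length ≤ K) {β v : ℚ}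
    (hv : v = common x y * (l.map fun d => (d.2 : ℚ) / d.1).sum + β)
    (hv0 : -(1 / 8) ≤ v) (hv1 : v < 1 / 4) :
    (eval (testRound w K l β) x y (.inr 0) = .inl true ∧ 0 < v) ∨
    (eval (testRound w K l β) x y (.inr 0) = .inl false ∧ v < 0) ∨
    (eval (testRound w K l β) x y (.inr 0) = .inr 0 ∧ -(1 / 16) ≤ v ∧ v < 1 / 8) := by
  obtain ⟨z, N, δ, h1, hδ0, hδ1, h2⟩ := eval_phase hK x y l hl (W₀ := 1) (z := 0)
    (by rw [Fin.val_zero]; exact one_pos)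
  have hδ : δ ≤ 1 / 16 := by
    refine hδ1.trans ?_
    rw [div_le_div_iff₀ (by exact_mod_cast hK) (by norm_num)]
    have : (16 * l.length : ℚ) ≤ K := by exact_mod_cast hlen
    linarith
  have hu : (z : ℚ) / lastModulus K 1 l + β = (v - δ) + N := by
    rw [h2, hv]; simp; ring
  have hround : round (v - δ) = 0 := by
    rw [round_eq_zero_iff, Set.mem_Ico]
    constructor <;> linarith
  have hr : ((z : ℚ) / lastModulus K 1 l + β) - round ((z : ℚ) / lastModulus K 1 l + β) =
      v - δ := by
    rw [hu, round_add_intCast, hround]; push_cast; ring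
  have heval : eval (testRound w K l β) x y (.inr 0) =
      if 1 / 16 ≤ v - δ then .inl true else if v - δ < -(1 / 16) then .inl false else .inr 0 := by
    rw [testRound, eval_append, h1, ← hr]; rfl
  rw [heval]
  split_ifs with c1 c2
  · exact .inl ⟨rfl, by linarith⟩
  · exact .inr (.inl ⟨rfl, by linarith⟩)
  · exact .inr (.inr ⟨rfl, by linarith, by linarith⟩)

theorem eval_testRound_inl (x y : Fin n → Bool) (l : List (ℕ × ℤ)) (β : ℚ) (b : Bool) :
    eval (testRound w K l β) x y (.inl b) = .inl b := by
  have hpass : ∀ W e, eval (countPass w W e) x y (.inl b) = .inl b := by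
    intro W e
    unfold countPass
    induction List.finRange n with
    | nil => rfl
    | cons i l ih => exact ih
  have hphase : ∀ W₀, eval (phase w K W₀ l) x y (.inl b) = .inl b := by
    induction l with
    | nil => intro; rfl
    | cons d l ih =>
      intro W₀
      rw [phase, ← List.singleton_append, eval_append, eval_append]
      exact (congrArg _ (hpass _ _)).trans (ih _)
  rw [testRound, eval_append, hphase]
  rfl

theorem length_testRound (l : List (ℕ × ℤ)) (β : ℚ) :
    (testRound (n := n) w K l β).length = l.length * (n + 1) + 1 := by
  have hphase : ∀ W₀, (phase (n := n) w K W₀ l).length = l.length * (n + 1) := by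
    induction l with
    | nil => simp [phase]
    | cons d l ih =>
      intro W₀
      simp [phase, countPass, ih]
      ring
  simp [testRound, hphase]

variable (w K) in
/-- The program for Majority with `J` rounds, where the entries `(q, a)` of `l` satisfy
`∑ a / q = 1 / L`. Round `j` estimates `(4 * S + 1 - 2 * n) * 2 ^ j / L` modulo one, where `S` is the
number of common ones. The integer `4 * S + 1 - 2 * n` is positive if and only if `S ≥ n / 2`, and it
never vanishes. -/
noncomputable def program (l : List (ℕ × ℤ)) (L J : ℕ) :
    List (AndStep (Fin n → Bool) (Fin n → Bool) (State w)) :=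
  (List.range J).flatMap fun j =>
    testRound w K (l.map fun d => (d.1, 4 * 2 ^ j * d.2)) ((1 - 2 * n) * 2 ^ j / L)

theorem length_program (l : List (ℕ × ℤ)) (L J : ℕ) :
    (program (n := n) w K l L J).length = J * (l.length * (n + 1) + 1) := by
  simp [program, List.length_flatMap, length_testRound]

/-- A verdict is correct, and as long as none is given, the quantity to be estimated next lies in
`[-1/8, 1/4)`, so that its residue modulo one reveals its sign or shows it to be small. -/
theorem eval_program_aux (hK : 0 < K) (x y : Fin n → Bool) {l : List (ℕ × ℤ)}
    (hl : ∀ d ∈ l, 0 < d.1 ∧ gridSize K d.1 ≤ w) (hlen : 16 * l.length ≤ K) {L : ℕ}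
    (hsum : (l.map fun d => (d.2 : ℚ) / d.1).sum = 1 / L) (hL : 8 * (2 * n + 1) < L) (J : ℕ) :
    (eval (program w K l L J) x y (.inr 0) = .inl true ∧ (0 : ℚ) < 4 * common x y + 1 - 2 * n) ∨
    (eval (program w K l L J) x y (.inr 0) = .inl false ∧ 4 * common x y + 1 - 2 * n < (0 : ℚ)) ∨
    (eval (program w K l L J) x y (.inr 0) = .inr 0 ∧
      -(1 / 8) ≤ (4 * common x y + 1 - 2 * n : ℚ) * 2 ^ J / L ∧
      (4 * common x y + 1 - 2 * n : ℚ) * 2 ^ J / L < 1 / 4) := by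
  have hLq : (0 : ℚ) < L := by exact_mod_cast (by omega : 0 < L)
  induction J with
  | zero =>
    refine .inr (.inr ⟨rfl, ?_⟩)
    have hS : common x y ≤ n := by
      refine (Finset.sum_le_card_nsmul _ _ 1 fun i _ => Bool.toNat_le _).trans (by simp)
    have hS' : (common x y : ℚ) ≤ n := by exact_mod_cast hS
    have hL' : (8 * (2 * n + 1) : ℚ) < L := by exact_mod_cast hL
    have hS0 : (0 : ℚ) ≤ common x y := by positivity
    constructor
    · rw [le_div_iff₀ hLq]; linarith
    · rw [div_lt_iff₀ hLq]; linarith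
  | succ J ih =>
    have hsucc : eval (program w K l L (J + 1)) x y (.inr 0) =
        eval (testRound w K (l.map fun d => (d.1, 4 * 2 ^ J * d.2)) ((1 - 2 * n) * 2 ^ J / L)) x y
          (eval (program w K l L J) x y (.inr 0)) := by
      rw [program, List.range_succ, List.flatMap_append, eval_append]
      simp [program]
    rw [hsucc]
    rcases ih with ⟨h, hE⟩ | ⟨h, hE⟩ | ⟨h, h0, h1⟩
    · rw [h, eval_testRound_inl]; exact .inl ⟨rfl, hE⟩
    · rw [h, eval_testRound_inl]; exact .inr (.inl ⟨rfl, hE⟩)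
    · rw [h]
      have hsum' : ((l.map fun d => (d.1, 4 * 2 ^ J * d.2)).map
          fun d : ℕ × ℤ => (d.2 : ℚ) / d.1).sum = 4 * 2 ^ J * (1 / L) := by
        rw [← hsum, ← List.sum_map_mul_left, List.map_map]
        congr 1
        refine List.map_congr_left fun d _ => ?_
        simp [mul_div_assoc]
      have hpos : (0 : ℚ) < 2 ^ J / L := by positivity
      rcases eval_testRound hK x y (l := l.map fun d => (d.1, 4 * 2 ^ J * d.2))
        (β := (1 - 2 * n) * 2 ^ J / L) (v := (4 * common x y + 1 - 2 * n : ℚ) * 2 ^ J / L)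
        (by
          intro d hd
          obtain ⟨d', hd', rfl⟩ := List.mem_map.1 hd
          exact hl d' hd')
        (by simpa using hlen) (by rw [hsum']; ring) h0 h1 with ⟨h, hv⟩ | ⟨h, hv⟩ | ⟨h, hv⟩
      · rw [mul_div_assoc] at hv
        exact .inl ⟨h, pos_of_mul_pos_left hv hpos.le⟩
      · rw [mul_div_assoc] at hv
        exact .inr (.inl ⟨h, by nlinarith⟩)
      · refine .inr (.inr ⟨h, ?_⟩)
        rw [pow_succ, ← mul_assoc, mul_div_right_comm]
        constructor <;> linarith [hv.1, hv.2]

end Programs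

theorem distributedMajority_eq {n : ℕ} (x y : Fin n → Bool) :
    distributedMajority n x y = decide ((0 : ℚ) < 4 * common x y + 1 - 2 * n) := by
  have h : ∑ i, (x i).toNat * (y i).toNat = common x y := by
    refine Finset.sum_congr rfl fun i _ => ?_
    cases x i <;> cases y i <;> rfl
  rw [distributedMajority, decide_eq_decide, h]
  have h1 : (0 : ℚ) < 4 * common x y + 1 - 2 * n ↔ 2 * n < 4 * common x y + 1 := by
    rw [sub_pos]; exact_mod_cast Iff.rfl
  have h2 : ((common x y : ℕ) : ℚ) ≥ (n : ℚ) / 2 ↔ n ≤ 2 * common x y := by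
    rw [ge_iff_le, div_le_iff₀ two_pos, mul_comm]; exact_mod_cast Iff.rfl
  rw [h1, h2]
  omega

/-- The size of the program is of order `m ^ 3 * n`: there are `2 * m` rounds of at most `2 * m`
passes each, and `O(m)` states. -/
theorem hasGardenHoseProtocol (n m : ℕ) (hm : 8 * (2 * n + 1) < 2 ^ m) :
    ∃ s ≤ 8 * (2 * m * (2 * m * (n + 1) + 1) + 1) * (34 * m + 2),
      HasGardenHoseProtocol (distributedMajority n) s := by
  have hm0 : 0 < m := by
    rcases m.eq_zero_or_pos with rfl | h
    · omega
    · exact h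
  obtain ⟨l, hlen, hl, hsum⟩ := exists_list_sum_eq_one_div_centralBinom hm0
  set L := m.centralBinom
  have hcentral : 4 ^ m ≤ 2 * m * L := Nat.four_pow_le_two_mul_self_mul_centralBinom m hm0
  have hL1 : 2 ^ m ≤ L := by
    have h1 : 2 * m ≤ 2 ^ m := by
      obtain ⟨k, rfl⟩ := Nat.exists_eq_succ_of_ne_zero hm0.ne'
      have := Nat.lt_two_pow_self (n := k)
      rw [pow_succ]; omega
    have h2 : 2 ^ m * 2 ^ m ≤ 2 ^ m * L := by
      rw [← mul_pow]; exact hcentral.trans (by gcongr)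
    exact Nat.le_of_mul_le_mul_left h2 (by positivity)
  have hL2 : L ≤ 4 ^ m := Nat.centralBinom_le_four_pow m
  have : NeZero (34 * m) := ⟨by omega⟩
  have hgrid : ∀ d ∈ l, 0 < d.1 ∧ gridSize (32 * m) d.1 ≤ 34 * m := by
    intro d hd
    obtain ⟨h0, h1⟩ := hl d hd
    refine ⟨h0, ?_⟩
    have := Nat.mul_div_le (32 * m) d.1
    rw [gridSize, mul_add]
    omega
  refine ⟨_, ?_, AndStep.hasGardenHoseProtocol (program (34 * m) (32 * m) l L (2 * m)) (.inr 0)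
    (Sum.elim id fun _ => false) (f := distributedMajority n) fun x y => ?_⟩
  · rw [length_program, Fintype.card_sum, Fintype.card_bool, Fintype.card_fin, add_comm 2]
    gcongr
  · rw [distributedMajority_eq]
    rcases eval_program_aux (by omega) x y hgrid (by omega) hsum (by omega) (2 * m) with
      ⟨h, hE⟩ | ⟨h, hE⟩ | ⟨h, h0, h1⟩
    · simp [h, hE]
    · rw [decide_eq_false hE.not_gt, h]; rfl
    · -- The odd integer `4 * S + 1 - 2 * n` is at least 1 in absolute value, and `L ≤ 2 ^ (2 * m)`.
      exfalso
      have hLq : (0 : ℚ) < L := by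
        exact_mod_cast Nat.centralBinom_pos m
      have hpow : (L : ℚ) ≤ 2 ^ (2 * m) := by rw [pow_mul]; norm_num; exact_mod_cast hL2
      rw [le_div_iff₀ hLq] at h0
      rw [div_lt_iff₀ hLq] at h1
      have hodd : (4 * common x y + 1 - 2 * n : ℤ) ≤ -1 ∨ (1 : ℤ) ≤ 4 * common x y + 1 - 2 * n := by
        omega
      rcases hodd with hE | hE
      · have hE : (4 * common x y + 1 - 2 * n : ℚ) ≤ -1 := by exact_mod_cast hE
        nlinarith
      · have hE : (1 : ℚ) ≤ 4 * common x y + 1 - 2 * n := by exact_mod_cast hE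
        nlinarith

end Majority

/-! ### Asymptotics -/

/-- The number of rounds and passes is governed by `m = Nat.log 2 n + 6`, the `6` making `2 ^ m` exceed
`8 * (2 * n + 1)`. -/
theorem exists_hasGardenHoseProtocol_distributedMajority (n : ℕ) :
    ∃ s ≤ 8 * (2 * (Nat.log 2 n + 6) * (2 * (Nat.log 2 n + 6) * (n + 1) + 1) + 1) *
        (34 * (Nat.log 2 n + 6) + 2),
      HasGardenHoseProtocol (distributedMajority n) s := by
  refine Majority.hasGardenHoseProtocol n _ ?_
  have h := Nat.lt_pow_succ_log_self one_lt_two n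
  have h' : 2 ^ (Nat.log 2 n + 6) = 32 * 2 ^ (Nat.log 2 n).succ := by
    rw [Nat.succ_eq_add_one, pow_add, pow_succ]; ring
  omega

theorem gardenHoseComplexity_distributedMajority_isBigO :
    (fun n : ℕ => (gardenHoseComplexity (distributedMajority n) : ℝ))
      =O[atTop] fun n : ℕ => (n : ℝ) * Real.log n ^ 3 := by
  refine IsBigO.of_bound (8 * 11 * 36 * 8 ^ 3) ?_
  filter_upwards [eventually_ge_atTop 3] with n hn
  obtain ⟨s, hs, hprot⟩ := exists_hasGardenHoseProtocol_distributedMajority n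
  have hle : gardenHoseComplexity (distributedMajority n) ≤ s := Nat.sInf_le hprot
  have hn' : (3 : ℝ) ≤ n := by exact_mod_cast hn
  have hlog : 1 ≤ Real.log n := by
    rw [Real.le_log_iff_exp_le (by linarith)]
    linarith [Real.exp_one_lt_d9]
  have hm : ((Nat.log 2 n + 6 : ℕ) : ℝ) ≤ 8 * Real.log n := by
    have h1 : (Nat.log 2 n : ℝ) * Real.log 2 ≤ Real.log n := by
      rw [← Real.log_pow]
      refine Real.log_le_log (by positivity) ?_
      exact_mod_cast Nat.pow_log_le_self 2 (by omega)
    have h2 := Real.log_two_gt_d9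
    have h3 : (0 : ℝ) ≤ Nat.log 2 n := by positivity
    push_cast
    nlinarith
  rw [Real.norm_of_nonneg (by positivity), Real.norm_of_nonneg (by positivity)]
  set M : ℝ := 8 * Real.log n with hM
  have hM1 : 1 ≤ M := by linarith
  calc (gardenHoseComplexity (distributedMajority n) : ℝ)
      ≤ (8 * (2 * (Nat.log 2 n + 6) * (2 * (Nat.log 2 n + 6) * (n + 1) + 1) + 1) *
        (34 * (Nat.log 2 n + 6) + 2) : ℕ) := by exact_mod_cast hle.trans hs
    _ = 8 * (2 * ((Nat.log 2 n + 6 : ℕ) : ℝ) *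
          (2 * ((Nat.log 2 n + 6 : ℕ) : ℝ) * (n + 1) + 1) + 1) *
        (34 * ((Nat.log 2 n + 6 : ℕ) : ℝ) + 2) := by push_cast; ring
    _ ≤ 8 * (2 * M * (2 * M * (n + 1) + 1) + 1) * (34 * M + 2) := by gcongr
    _ ≤ 8 * (11 * M ^ 2 * n) * (36 * M) := by
        have h1 : 2 * M * (n + 1) + 1 ≤ 5 * M * n := by nlinarith
        have h2 : 2 * M * (5 * M * n) + 1 ≤ 11 * M ^ 2 * n := by
          have : 1 ≤ M ^ 2 * n := by nlinarith
          nlinarith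
        gcongr
        · exact le_trans (by gcongr) h2
        · linarith
    _ = 8 * 11 * 36 * 8 ^ 3 * (n * Real.log n ^ 3) := by rw [hM]; ring

theorem mainTheorem2 :
    (∀ n : ℕ, ∃ s : ℕ, HasGardenHoseProtocol (distributedMajority n) s) ∧
    ((fun n : ℕ => (gardenHoseComplexity (distributedMajority n) : ℝ))
      =O[atTop] fun n : ℕ => (n : ℝ) * Real.log n ^ 3) ∧
    ¬ ((fun n : ℕ => (n : ℝ) ^ 2)
      =O[atTop] fun n : ℕ => (gardenHoseComplexity (distributedMajority n) : ℝ)) := by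
  refine ⟨fun n => ?_, gardenHoseComplexity_distributedMajority_isBigO, fun h => ?_⟩
  · obtain ⟨s, -, hs⟩ := exists_hasGardenHoseProtocol_distributedMajority n
    exact ⟨s, hs⟩
  · have hlog : (fun n : ℕ => Real.log n ^ 3) =o[atTop] fun n : ℕ => (n : ℝ) :=
      (Real.isLittleO_pow_log_id_atTop (n := 3)).comp_tendsto tendsto_natCast_atTop_atTop
    have hsmall : (fun n : ℕ => (n : ℝ) * Real.log n ^ 3) =o[atTop] fun n : ℕ => (n : ℝ) ^ 2 := by
      simpa only [pow_two] using (isBigO_refl (fun n : ℕ => (n : ℝ)) atTop).mul_isLittleO hlog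
    refine isLittleO_irrefl ?_
      ((h.trans gardenHoseComplexity_distributedMajority_isBigO).trans_isLittleO hsmall)
    refine Eventually.frequently ?_
    filter_upwards [eventually_gt_atTop 0] with n hn
    positivity
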